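/- Let $n\ge 1$ and let $x_1,\dots,x_n$ be independent random variables, each uniformly distributed on $\{1,\dots,n\}$. The algorithm LINEAR, run on the sequence $s=(x_1,\dots,x_n)$, starts with a vector $v=(v_1,\dots,v_n)$ of zeros and, for $i=1,2,\dots,n$ in turn, makes the comparison "$v_{s_i}>0$?": if it holds, LINEAR stops and returns FALSE; otherwise it increases $v_{s_i}$ by $1$ and goes on. If no comparison succeeds, it returns TRUE. Let $C_L=C_L(n)$ be the expected number of comparisons "$v_{s_i}>0$?" executed, and let $$R_1=R_1(n)=\sum_{k=1}^n p_k\,k,\qquad p_k=\frac{n!\,k}{(n-k)!\,n^{k+1}}\quad(1\le k\le n).$$ Then, for every $n\ge 1$, $$C_L = 1-\frac{n!}{n^n}+R_1=\sqrt{\frac{\pi n}{2}}+\frac23+\kappa(n)-\frac{n!}{n^n},$$ where $$\kappa(n)=\frac13-\sqrt{\frac{\pi n}{2}}+\sum_{k=1}^n\frac{n!\,k^2}{(n-k)!\,n^{k+1}},$$ and the sequence $(\kappa(n))_{n\ge1}$ is strictly decreasing and tends to $0$ as $n\to\infty$. -/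

import Mathlib

open MeasureTheory ProbabilityTheory Filter Topology
open scoped Nat

namespace Linear

/-- The main loop of the algorithm LINEAR. `v` is the current content of the working vector, the
list holds the entries `s_i, …, s_n` that are still to be examined. The result is the pair of the
returned truth value and the number of comparisons `v_{s_i} > 0` that were executed.
The alphabet `{1, …, n}` is represented by the `n`-element type `Fin n`. -/
def loop {n : ℕ} (v : Fin n → ℕ) : List (Fin n) → Bool × ℕ
  | [] => (true, 0)
  | a :: rest =>
    if v a > 0 then (false, 1)
    else
      let r := loop (Function.update v a (v a + 1)) rest
      (r.1, r.2 + 1)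

/-- LINEAR run on the sequence `s`: the working vector starts as the zero vector, and the entries
of `s` are examined from the first to the last. -/
def run {n : ℕ} (s : Fin n → Fin n) : Bool × ℕ :=
  loop (fun _ => 0) (List.ofFn s)

/-- The truth value returned by LINEAR on the input `s`. -/
def output {n : ℕ} (s : Fin n → Fin n) : Bool := (run s).1

/-- The number of comparisons executed by LINEAR on the input `s`. -/
def comparisons {n : ℕ} (s : Fin n → Fin n) : ℕ := (run s).2

/-- `p_k(n) = n! k / ((n - k)! n ^ (k + 1))`, for `1 ≤ k ≤ n`. -/
noncomputable def p (n k : ℕ) : ℝ :=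
  ((n ! : ℝ) * k) / (((n - k)! : ℝ) * (n : ℝ) ^ (k + 1))

/-- `R_i(n) = ∑_{k = 1}^n p_k(n) k ^ i`. -/
noncomputable def R (i n : ℕ) : ℝ :=
  ∑ k ∈ Finset.Icc 1 n, p n k * (k : ℝ) ^ i

/-- `κ(n) = 1/3 - √(π n / 2) + ∑_{k = 1}^n n! k² / ((n - k)! n ^ (k + 1))`. -/
noncomputable def kappa (n : ℕ) : ℝ :=
  1 / 3 - √(Real.pi * n / 2) +
    ∑ k ∈ Finset.Icc 1 n, ((n ! : ℝ) * (k : ℝ) ^ 2) / (((n - k)! : ℝ) * (n : ℝ) ^ (k + 1))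

end Linear

/-! Comparison number k+1 is executed exactly when the first k entries are distinct, so C_L is the
sum over k < n of the probabilities Q_k = `distinctProb n k`. Since n Q_{k+1} = (n-k) Q_k, summation
by parts gives R_1 = Q_0 + ... + Q_n - 1, which yields both formulas for C_L.

For `kappa`, an explicit antiderivative writes Q_0 + ... + Q_n as n² ∫ t e^{-nv} dv over v > 0,
where v = t - log(1+t) is `phase t`. Gamma integrals write √(πn/2) and 2/3 in the same way, with
√(2v) and 2v/3 in place of t. Hence `kappa n` is the mean of `profile` = (t - √(2v) - 2v/3)/v under
the Gamma density n² v e^{-nv}. As n grows this law shifts towards v = 0, so strict decrease follows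
from `strictMonoOn_profile`. The limit follows from `tendsto_profile`, a linear bound on `profile`,
and the mean 2/n of the law. -/

namespace Linear

/-! ### Counting comparisons -/

/-- The total number of comparisons over all inputs of length `m`, starting from the working
vector `v`. -/
theorem sum_loop_snd {n : ℕ} (m : ℕ) (v : Fin n → ℕ) :
    ∑ s : Fin m → Fin n, (loop v (List.ofFn s)).2
      = ∑ k ∈ Finset.range m,
          n ^ (m - k) * (n - (Finset.univ.filter fun a => 0 < v a).card).descFactorial k := by
  induction m generalizing v with
  | zero => simp [loop]
  | succ m ih =>
    -- Only the number j of marked letters matters. The k-th summand counts inputs whose first k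
    -- letters are distinct and unmarked.
    set j := (Finset.univ.filter fun a => 0 < v a).card with hj
    have hcard : ∀ a, ¬ 0 < v a →
        (Finset.univ.filter fun b => 0 < Function.update v a (v a + 1) b).card = j + 1 := by
      intro a ha
      rw [hj, ← Finset.card_insert_of_notMem (a := a) (by simpa using ha)]
      congr 1
      ext b
      by_cases hb : b = a
      · subst hb; simp
      · simp [hb]
    have hcompl : (Finset.univ.filter fun a => ¬ 0 < v a).card = n - j := by
      have := Finset.card_filter_add_card_filter_not (s := (Finset.univ : Finset (Fin n)))
        (fun a => 0 < v a)
      simp only [Finset.card_univ, Fintype.card_fin] at this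
      omega
    have hstep : ∀ a, ∑ s : Fin m → Fin n, (loop v (a :: List.ofFn s)).2
        = n ^ m + if 0 < v a then 0 else
          ∑ k ∈ Finset.range m, n ^ (m - k) * (n - (j + 1)).descFactorial k := by
      intro a
      by_cases ha : 0 < v a
      · simp [loop, ha]
      · simp only [loop, gt_iff_lt, ha, if_false, Finset.sum_add_distrib, ih, hcard a ha]
        simp [add_comm]
    rw [← (Fin.consEquiv fun _ : Fin (m + 1) => Fin n).sum_comp, Fintype.sum_prod_type]
    simp only [Fin.consEquiv_apply, List.ofFn_succ, Fin.cons_zero, Fin.cons_succ, hstep]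
    rw [Finset.sum_add_distrib, Finset.sum_ite, Finset.sum_const_zero, zero_add, Finset.sum_const,
      Finset.sum_const, hcompl, Finset.sum_range_succ', Finset.card_univ, Fintype.card_fin]
    simp only [smul_eq_mul, Nat.descFactorial_zero, Nat.sub_zero, mul_one]
    rw [add_comm, Finset.mul_sum, pow_succ']
    congr 1
    refine Finset.sum_congr rfl fun k _ => ?_
    rw [Nat.add_sub_add_right]
    rcases Nat.eq_zero_or_pos (n - j) with h0 | h0
    · simp [h0]
    · obtain ⟨d, hd⟩ := Nat.exists_eq_succ_of_ne_zero h0.ne'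
      rw [hd, Nat.succ_descFactorial_succ, show n - (j + 1) = d by omega,
        Nat.succ_eq_add_one]
      ring

/-- The probability that the first `k` entries of a uniform sequence over an `n`-element alphabet
are pairwise distinct. -/
noncomputable def distinctProb (n k : ℕ) : ℝ := (n.descFactorial k : ℝ) / (n : ℝ) ^ k

theorem distinctProb_zero (n : ℕ) : distinctProb n 0 = 1 := by simp [distinctProb]

theorem distinctProb_self (n : ℕ) : distinctProb n n = (n ! : ℝ) / (n : ℝ) ^ n := by
  simp [distinctProb, Nat.descFactorial_self]

theorem distinctProb_succ {n k : ℕ} (hn : 1 ≤ n) (hk : k ≤ n) :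
    n * distinctProb n (k + 1) = (n - k) * distinctProb n k := by
  have : (n : ℝ) ≠ 0 := by positivity
  rw [distinctProb, distinctProb, Nat.descFactorial_succ]
  push_cast [hk]
  field_simp
  ring

theorem distinctProb_eq_div {n k : ℕ} (hk : k ≤ n) :
    distinctProb n k = (n ! : ℝ) / ((n - k)! * (n : ℝ) ^ k) := by
  have h := Nat.factorial_mul_descFactorial hk
  have h' : ((n - k)! : ℝ) * n.descFactorial k = n ! := by exact_mod_cast h
  have : ((n - k)! : ℝ) ≠ 0 := by positivity
  rw [distinctProb, ← h', mul_div_mul_left _ _ this]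

theorem sum_comparisons {n : ℕ} (hn : 1 ≤ n) :
    (∑ s : Fin n → Fin n, (comparisons s : ℝ)) / (n : ℝ) ^ n
      = ∑ k ∈ Finset.range n, distinctProb n k := by
  have h := sum_loop_snd n (fun _ : Fin n => 0)
  have h' : ∑ s : Fin n → Fin n, (comparisons s : ℝ)
      = ∑ k ∈ Finset.range n, (n : ℝ) ^ (n - k) * n.descFactorial k := by
    simp only [lt_irrefl, Finset.filter_false, Finset.card_empty, Nat.sub_zero] at h
    exact_mod_cast h
  have hn0 : (n : ℝ) ≠ 0 := by positivity
  rw [h', Finset.sum_div]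
  refine Finset.sum_congr rfl fun k hk => ?_
  have hk : k ≤ n := (Finset.mem_range.1 hk).le
  rw [distinctProb, div_eq_div_iff (by positivity) (by positivity)]
  have : (n : ℝ) ^ n = n ^ (n - k) * n ^ k := by rw [← pow_add, Nat.sub_add_cancel hk]
  rw [this]; ring

/-- The recursion gives k² Q_k / n = k Q_k - k Q_{k+1}, which sums by parts. The boundary term
vanishes at m = n. -/
theorem sum_mul_distinctProb {n : ℕ} (hn : 1 ≤ n) {m : ℕ} (hm : m ≤ n) :
    ∑ k ∈ Finset.range (m + 1), distinctProb n k * (k : ℝ) ^ 2 / n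
      = ∑ k ∈ Finset.range (m + 1), distinctProb n k - 1
        - m * distinctProb n m * (n - m) / n := by
  have hn0 : (n : ℝ) ≠ 0 := by positivity
  induction m with
  | zero => simp [distinctProb_zero]
  | succ m ih =>
    have h := distinctProb_succ hn (Nat.le_of_succ_le hm)
    rw [Finset.sum_range_succ, ih (by omega), Finset.sum_range_succ _ (m + 1)]
    push_cast
    field_simp
    linear_combination (m : ℝ) * h

theorem R_one_eq {n : ℕ} (hn : 1 ≤ n) :
    R 1 n = ∑ k ∈ Finset.range (n + 1), distinctProb n k - 1 := by
  have h := sum_mul_distinctProb hn le_rfl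
  rw [sub_self, mul_zero, zero_div, sub_zero] at h
  rw [← h, Finset.sum_range_succ', R, ← Finset.Ico_add_one_right_eq_Icc, Finset.sum_Ico_eq_sum_range]
  simp only [Nat.cast_zero, ne_eq, OfNat.ofNat_ne_zero, not_false_eq_true, zero_pow, mul_zero,
    zero_div, add_zero, Nat.add_sub_cancel]
  refine Finset.sum_congr rfl fun k hk => ?_
  have hk : k + 1 ≤ n := by have := Finset.mem_range.1 hk; omega
  have hn0 : (n : ℝ) ≠ 0 := by positivity
  have hf : ((n - (k + 1))! : ℝ) ≠ 0 := by positivity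
  rw [add_comm 1 k, p, distinctProb_eq_div hk]
  field_simp
  ring

theorem kappa_eq (n : ℕ) : kappa n = 1 / 3 - √(Real.pi * n / 2) + R 1 n := by
  rw [kappa, R]
  congr 1
  refine Finset.sum_congr rfl fun k _ => ?_
  rw [p]; ring

theorem integral_comparisons {n : ℕ} (hn : 1 ≤ n) {Ω : Type*} [MeasurableSpace Ω]
    (P : Measure Ω) [IsProbabilityMeasure P] (x : Fin n → Ω → Fin n)
    (hx : ∀ i, Measurable (x i)) (hind : iIndepFun x P)
    (hunif : ∀ i k, P.real {ω | x i ω = k} = 1 / (n : ℝ)) :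
    ∫ ω, (comparisons (fun i => x i ω) : ℝ) ∂P = 1 - (n ! : ℝ) / (n : ℝ) ^ n + R 1 n := by
  have hX : Measurable fun ω i => x i ω := measurable_pi_lambda _ hx
  have hmap := (iIndepFun_iff_map_fun_eq_pi_map fun i => (hx i).aemeasurable).1 hind
  have hprob : IsProbabilityMeasure (P.map fun ω i => x i ω) :=
    Measure.isProbabilityMeasure_map hX.aemeasurable
  have hsing : ∀ s : Fin n → Fin n,
      (P.map fun ω i => x i ω).real {s} = 1 / (n : ℝ) ^ n := by
    intro s
    have : ∀ i, IsProbabilityMeasure (P.map (x i)) := fun i =>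
      Measure.isProbabilityMeasure_map (hx i).aemeasurable
    rw [hmap, measureReal_def, Measure.pi_singleton, ENNReal.toReal_prod]
    have : ∀ i, ((P.map (x i)) {s i}).toReal = 1 / (n : ℝ) := by
      intro i
      rw [Measure.map_apply (hx i) (measurableSet_singleton _), ← hunif i (s i)]
      rfl
    simp [this]
  calc ∫ ω, (comparisons (fun i => x i ω) : ℝ) ∂P
      = ∫ s, (comparisons s : ℝ) ∂(P.map fun ω i => x i ω) :=
        (integral_map (f := fun s => (comparisons s : ℝ)) hX.aemeasurable
          (measurable_of_finite _).aestronglyMeasurable).symm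
    _ = (∑ s : Fin n → Fin n, (comparisons s : ℝ)) / (n : ℝ) ^ n := by
        rw [integral_fintype .of_finite, Finset.sum_div]
        refine Finset.sum_congr rfl fun s _ => ?_
        rw [hsing, smul_eq_mul]; ring
    _ = 1 - (n ! : ℝ) / (n : ℝ) ^ n + R 1 n := by
        rw [sum_comparisons hn, R_one_eq hn, Finset.sum_range_succ, distinctProb_self]; ring

/-! ### The change of variable v = t - log(1+t) -/

/-- The exponent in `(1 + t) ^ n * exp (-n t) = exp (-n * phase t)`. -/
noncomputable def phase (t : ℝ) : ℝ := t - Real.log (1 + t)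

theorem hasDerivAt_phase {t : ℝ} (ht : -1 < t) : HasDerivAt phase (t / (1 + t)) t := by
  have h1 : (1 + t) ≠ 0 := by linarith
  have h := (hasDerivAt_id t).sub (((hasDerivAt_id t).const_add 1).log h1)
  refine h.congr_deriv ?_
  simp only [id]
  field_simp
  ring

theorem phase_zero : phase 0 = 0 := by simp [phase]

theorem continuousOn_phase : ContinuousOn phase (Set.Ici 0) := fun t ht =>
  (hasDerivAt_phase (by linarith [Set.mem_Ici.1 ht])).continuousAt.continuousWithinAt

theorem strictMonoOn_phase : StrictMonoOn phase (Set.Ici 0) := by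
  refine strictMonoOn_of_deriv_pos (convex_Ici 0) continuousOn_phase fun t ht => ?_
  rw [interior_Ici, Set.mem_Ioi] at ht
  rw [(hasDerivAt_phase (by linarith)).deriv]
  positivity

theorem phase_pos {t : ℝ} (ht : 0 < t) : 0 < phase t := by
  simpa [phase_zero] using strictMonoOn_phase Set.self_mem_Ici ht.le ht

theorem tendsto_phase_atTop : Tendsto phase atTop atTop := by
  have h : ∀ t : ℝ, 0 ≤ t → t / 2 - Real.log 2 ≤ phase t := by
    intro t ht
    have h2 := Real.log_le_sub_one_of_pos (show (0 : ℝ) < (1 + t) / 2 by positivity)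
    rw [Real.log_div (by positivity) two_ne_zero] at h2
    rw [phase]
    linarith
  refine tendsto_atTop_mono' _ ((eventually_ge_atTop 0).mono h) ?_
  exact tendsto_atTop_add_const_right _ _ (tendsto_id.atTop_div_const two_pos)

theorem exists_phase_eq {v : ℝ} (hv : 0 < v) : ∃ t, 0 < t ∧ phase t = v := by
  obtain ⟨b, hb, hb0⟩ := ((tendsto_phase_atTop.eventually_ge_atTop v).and
    (eventually_ge_atTop 0)).exists
  obtain ⟨t, ht, rfl⟩ := intermediate_value_Icc hb0 (continuousOn_phase.mono Set.Icc_subset_Ici_self)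
    ⟨phase_zero.trans_le hv.le, hb⟩
  refine ⟨t, lt_of_le_of_ne ht.1 ?_, rfl⟩
  rintro rfl
  exact hv.ne' phase_zero

theorem phase_image_Ioi : phase '' Set.Ioi 0 = Set.Ioi 0 := by
  ext v
  constructor
  · rintro ⟨t, ht, rfl⟩
    exact phase_pos ht
  · intro hv
    obtain ⟨t, ht, h⟩ := exists_phase_eq hv
    exact ⟨t, ht, h⟩

/-! ### Monotonicity and limit of the profile -/

section LogBounds

theorem hasDerivAt_log_sq_sub_one {s : ℝ} (hs : 1 < s) :
    HasDerivAt (fun s : ℝ => Real.log ((s ^ 2 - 1) / 8)) (2 * s / (s ^ 2 - 1)) s := by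
  have h0 : (s ^ 2 - 1) ≠ 0 := by nlinarith
  have h := ((((hasDerivAt_id s).pow 2).sub_const 1).div_const 8).log
    (by simpa using h0)
  refine h.congr_deriv ?_
  simp only [id, Pi.pow_apply]
  field_simp
  norm_num
  ring

theorem log_lt_of_three_lt {s : ℝ} (hs : 3 < s) :
    Real.log ((s ^ 2 - 1) / 8) < (s ^ 2 - 9) * (s + 5) / (4 * (s + 1) ^ 2) := by
  let E : ℝ → ℝ := fun s => (s ^ 2 - 9) * (s + 5) / (4 * (s + 1) ^ 2) - Real.log ((s ^ 2 - 1) / 8)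
  have hd : ∀ s : ℝ, 3 ≤ s →
      HasDerivAt E ((s - 3) ^ 3 * (s + 3) / (4 * (s + 1) ^ 3 * (s - 1))) s := by
    intro s hs
    have h1 : s + 1 ≠ 0 := by linarith
    have h2 : s - 1 ≠ 0 := by linarith
    have h3 : s ^ 2 - 1 ≠ 0 := by nlinarith
    have h := (((((hasDerivAt_id s).pow 2).sub_const 9).mul ((hasDerivAt_id s).add_const 5)).div
      ((((hasDerivAt_id s).add_const 1).pow 2).const_mul 4) (by simpa using h1)).sub
      (hasDerivAt_log_sq_sub_one (by linarith : 1 < s))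
    refine h.congr_deriv ?_
    simp only [id, Pi.pow_apply, Pi.mul_apply]
    rw [show s ^ 2 - 1 = (s + 1) * (s - 1) by ring]
    field_simp
    ring
  have hmono : StrictMonoOn E (Set.Ici 3) := by
    refine strictMonoOn_of_deriv_pos (convex_Ici 3)
      (fun s hs => (hd s hs).continuousAt.continuousWithinAt) fun s hs => ?_
    rw [interior_Ici, Set.mem_Ioi] at hs
    rw [(hd s hs.le).deriv]
    have : 0 < s - 3 := by linarith
    have : 0 < s - 1 := by linarith
    positivity
  have h := hmono Set.self_mem_Ici hs.le hs
  norm_num [E] at h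
  exact h

theorem lt_log_of_three_lt {s : ℝ} (hs : 3 < s) :
    (s ^ 2 - 9) * (5 - s) / (4 * (s - 1) ^ 2) < Real.log ((s ^ 2 - 1) / 8) := by
  let E : ℝ → ℝ := fun s => Real.log ((s ^ 2 - 1) / 8) - (s ^ 2 - 9) * (5 - s) / (4 * (s - 1) ^ 2)
  have hd : ∀ s : ℝ, 3 ≤ s →
      HasDerivAt E ((s + 3) ^ 3 * (s - 3) / (4 * (s - 1) ^ 3 * (s + 1))) s := by
    intro s hs
    have h1 : s + 1 ≠ 0 := by linarith
    have h2 : s - 1 ≠ 0 := by linarith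
    have h3 : s ^ 2 - 1 ≠ 0 := by nlinarith
    have h := (hasDerivAt_log_sq_sub_one (by linarith : 1 < s)).sub
      (((((hasDerivAt_id s).pow 2).sub_const 9).mul ((hasDerivAt_id s).const_sub 5)).div
      ((((hasDerivAt_id s).sub_const 1).pow 2).const_mul 4) (by simpa using h2))
    refine h.congr_deriv ?_
    simp only [id, Pi.pow_apply, Pi.mul_apply]
    rw [show s ^ 2 - 1 = (s + 1) * (s - 1) by ring]
    field_simp
    ring
  have hmono : StrictMonoOn E (Set.Ici 3) := by
    refine strictMonoOn_of_deriv_pos (convex_Ici 3)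
      (fun s hs => (hd s hs).continuousAt.continuousWithinAt) fun s hs => ?_
    rw [interior_Ici, Set.mem_Ioi] at hs
    rw [(hd s hs.le).deriv]
    have : 0 < s - 3 := by linarith
    have : 0 < s - 1 := by linarith
    positivity
  have h := hmono Set.self_mem_Ici hs.le hs
  norm_num [E] at h
  linarith

end LogBounds

/-- The inequality is quadratic in log(1+t) and says that the logarithm lies strictly between the
two roots, which are the bounds of `log_lt_of_three_lt` and `lt_log_of_three_lt`. -/
theorem two_mul_sq_lt_sq_mul_phase {t : ℝ} (ht : 0 < t) :
    2 * (t ^ 2 - (1 + t) * phase t) ^ 2 < t ^ 2 * phase t := by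
  -- The discriminant is a square times 9 + 8t, so s = √(9 + 8t) makes both roots rational.
  obtain ⟨s, hs, rfl⟩ : ∃ s : ℝ, 3 < s ∧ t = (s ^ 2 - 9) / 8 := by
    refine ⟨√(9 + 8 * t), ?_, ?_⟩
    · exact Real.lt_sqrt_of_sq_lt (by linarith)
    · rw [Real.sq_sqrt (by positivity)]; ring
  have hU := log_lt_of_three_lt hs
  have hV := lt_log_of_three_lt hs
  rw [phase, show 1 + (s ^ 2 - 9) / 8 = (s ^ 2 - 1) / 8 by ring]
  set L := Real.log ((s ^ 2 - 1) / 8)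
  have h1 : s + 1 ≠ 0 := by linarith
  have h2 : s - 1 ≠ 0 := by linarith
  have h3 : 0 < s ^ 2 - 1 := by nlinarith
  have key : ((s ^ 2 - 9) / 8) ^ 2 * ((s ^ 2 - 9) / 8 - L)
      - 2 * (((s ^ 2 - 9) / 8) ^ 2 - (s ^ 2 - 1) / 8 * ((s ^ 2 - 9) / 8 - L)) ^ 2
      = 2 * ((s ^ 2 - 1) / 8) ^ 2 * (((s ^ 2 - 9) * (s + 5) / (4 * (s + 1) ^ 2) - L)
        * (L - (s ^ 2 - 9) * (5 - s) / (4 * (s - 1) ^ 2))) := by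
    rw [show s ^ 2 - 1 = (s + 1) * (s - 1) by ring]
    field_simp
    ring
  have := mul_pos (sub_pos.2 hU) (sub_pos.2 hV)
  have : 0 < 2 * ((s ^ 2 - 1) / 8) ^ 2 * (((s ^ 2 - 9) * (s + 5) / (4 * (s + 1) ^ 2) - L)
        * (L - (s ^ 2 - 9) * (5 - s) / (4 * (s - 1) ^ 2))) := by positivity
  linarith

/-- The function `(t - √(2 v) - 2 v / 3) / v` of `v = phase t`, parametrized by `t`. -/
noncomputable def profile (t : ℝ) : ℝ := t / phase t - √2 / √(phase t) - 2 / 3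

theorem phase_mul_profile {t : ℝ} (ht : 0 < t) :
    phase t * profile t = t - √2 * √(phase t) - 2 / 3 * phase t := by
  have hv := phase_pos ht
  have hr := Real.sqrt_pos.2 hv
  have hsq := Real.sq_sqrt hv.le
  rw [profile]
  set r := √(phase t)
  rw [← hsq]
  field_simp

theorem strictMonoOn_profile : StrictMonoOn profile (Set.Ioi 0) := by
  have hd : ∀ t : ℝ, 0 < t → HasDerivAt profile
      (((1 + t) * phase t - t ^ 2 + √2 * √(phase t) * t / 2) / (phase t ^ 2 * (1 + t))) t := by
    intro t ht
    have hv := phase_pos ht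
    have hr := Real.sqrt_pos.2 hv
    have hp := hasDerivAt_phase (by linarith : -1 < t)
    have h := (((hasDerivAt_id t).div hp hv.ne').sub
      ((hasDerivAt_const t √2).div (hp.sqrt hv.ne') hr.ne')).sub_const (2 / 3)
    refine h.congr_deriv ?_
    have hsq := Real.sq_sqrt hv.le
    simp only [id]
    set r := √(phase t)
    rw [← hsq]
    field_simp
    ring
  refine strictMonoOn_of_deriv_pos (convex_Ioi 0)
    (fun t ht => (hd t ht).continuousAt.continuousWithinAt) fun t ht => ?_
  rw [interior_Ioi, Set.mem_Ioi] at ht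
  rw [(hd t ht).deriv]
  have hv := phase_pos ht
  -- Positivity of the derivative's numerator. The left side may have either sign; squaring only
  -- needs the right side nonnegative.
  have h : (t ^ 2 - (1 + t) * phase t) < √2 * √(phase t) * t / 2 := by
    refine lt_of_pow_lt_pow_left₀ 2 (by positivity) ?_
    have := two_mul_sq_lt_sq_mul_phase ht
    rw [div_pow, mul_pow, mul_pow, Real.sq_sqrt hv.le, Real.sq_sqrt two_pos.le]
    linarith
  exact div_pos (by linarith) (by positivity)

theorem tendsto_log_remainder :
    Tendsto (fun t : ℝ => (Real.log (1 + t) - t + t ^ 2 / 2) / t ^ 3) (𝓝[>] 0) (𝓝 (1 / 3)) := by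
  rw [tendsto_iff_norm_sub_tendsto_zero]
  have hlim : Tendsto (fun t : ℝ => t / (1 - t)) (𝓝[>] 0) (𝓝 0) := by
    have : ContinuousAt (fun t : ℝ => t / (1 - t)) 0 := by
      apply ContinuousAt.div <;> first | fun_prop | norm_num
    simpa using this.tendsto.mono_left nhdsWithin_le_nhds
  refine squeeze_zero' (Eventually.of_forall fun _ => norm_nonneg _) ?_ hlim
  filter_upwards [Ioo_mem_nhdsGT (zero_lt_one (α := ℝ))] with t ht
  have h := Real.abs_log_sub_add_sum_range_le (x := -t) (by rw [abs_neg, abs_of_pos ht.1]; exact ht.2) 3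
  rw [abs_neg, abs_of_pos ht.1] at h
  simp only [Finset.sum_range_succ, Finset.sum_range_zero] at h
  norm_num at h
  have h1 : 0 < 1 - t := by linarith [ht.2]
  have h0 := ht.1
  have e : (Real.log (1 + t) - t + t ^ 2 / 2) / t ^ 3 - 1 / 3
      = (-t + t ^ 2 / 2 + (-t) ^ 3 / 3 + Real.log (1 + t)) / t ^ 3 := by
    field_simp; ring
  rw [e, Real.norm_eq_abs, abs_div, abs_of_pos (pow_pos h0 3), div_le_iff₀ (by positivity)]
  refine h.trans_eq ?_
  field_simp

theorem tendsto_profile : Tendsto profile (𝓝[>] 0) (𝓝 0) := by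
  have hid : Tendsto (fun t : ℝ => t) (𝓝[>] 0) (𝓝 0) := tendsto_id.mono_left nhdsWithin_le_nhds
  have hw := tendsto_log_remainder
  have hp : Tendsto (fun t : ℝ => 1 / 2 - t * ((Real.log (1 + t) - t + t ^ 2 / 2) / t ^ 3))
      (𝓝[>] 0) (𝓝 (1 / 2)) := by
    simpa only [zero_mul, sub_zero] using (hid.mul hw).const_sub (1 / 2)
  -- Rationalizing, (t - √(2v))/v = (t² - 2v)/(v(t + √(2v))). With w the cubic log remainder this is
  -- 2w/((1/2 - tw)(1 + √(2(1/2 - tw)))), which tends to 2/3.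
  have hs := (hp.const_mul 2).sqrt
  have hq := (hw.const_mul 2).div (hp.mul (hs.const_add 1)) (by norm_num)
  have hq := hq.sub_const (2 / 3)
  norm_num at hq
  refine hq.congr' ?_
  filter_upwards [self_mem_nhdsWithin] with t ht
  have ht : 0 < t := ht
  have hv := phase_pos ht
  set w := (Real.log (1 + t) - t + t ^ 2 / 2) / t ^ 3 with hwdef
  have hpw : 1 / 2 - t * w = phase t / t ^ 2 := by
    rw [hwdef, phase]; field_simp; ring
  have hww : 2 * w = (t ^ 2 - 2 * phase t) / t ^ 3 := by
    rw [hwdef, phase]; field_simp; ring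
  have hst : √(phase t / t ^ 2) = √(phase t) / t := by
    rw [Real.sqrt_div hv.le, Real.sqrt_sq ht.le]
  rw [hpw, hww, hst, profile]
  congr 1
  have hr := Real.sqrt_pos.2 hv
  have hsq := Real.sq_sqrt hv.le
  have h2 := Real.sq_sqrt (two_pos (α := ℝ)).le
  have h2' := Real.sqrt_pos.2 (two_pos (α := ℝ))
  set r := √(phase t)
  set q := √(2 : ℝ)
  rw [← hsq]
  have e2 : (2 : ℝ) * r ^ 2 = q ^ 2 * r ^ 2 := by rw [h2]
  rw [e2]
  field_simp
  ring

/-! ### Integral representation of kappa -/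

theorem integral_phase_rpow {a c : ℝ} (ha : 0 < a) (hc : 0 < c) :
    IntegrableOn (fun t => phase t ^ (a - 1) * Real.exp (-(c * phase t)) * (t / (1 + t)))
      (Set.Ioi 0) ∧
    ∫ t in Set.Ioi 0, phase t ^ (a - 1) * Real.exp (-(c * phase t)) * (t / (1 + t))
      = (1 / c) ^ a * Real.Gamma a := by
  have hd : ∀ t ∈ Set.Ioi (0 : ℝ), HasDerivWithinAt phase (t / (1 + t)) (Set.Ioi 0) t :=
    fun t ht => (hasDerivAt_phase (by linarith [Set.mem_Ioi.1 ht])).hasDerivWithinAt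
  have hinj : Set.InjOn phase (Set.Ioi 0) := (strictMonoOn_phase.mono Set.Ioi_subset_Ici_self).injOn
  have hval := Real.integral_rpow_mul_exp_neg_mul_Ioi ha hc
  have hint : IntegrableOn (fun v : ℝ => v ^ (a - 1) * Real.exp (-(c * v))) (Set.Ioi 0) := by
    -- A non-integrable function has integral 0 by convention, whereas this value is positive.
    refine not_imp_comm.1 integral_undef ?_
    rw [hval]
    have := Real.Gamma_pos_of_pos ha
    positivity
  have hcongr : Set.EqOn (fun t => |t / (1 + t)| •
      (phase t ^ (a - 1) * Real.exp (-(c * phase t))))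
      (fun t => phase t ^ (a - 1) * Real.exp (-(c * phase t)) * (t / (1 + t))) (Set.Ioi 0) := by
    intro t ht
    have ht : 0 < t := ht
    simp only [smul_eq_mul]
    rw [abs_of_pos (by positivity), mul_comm]
  constructor
  · rw [← phase_image_Ioi, integrableOn_image_iff_integrableOn_abs_deriv_smul measurableSet_Ioi
      hd hinj] at hint
    exact hint.congr_fun hcongr measurableSet_Ioi
  · have h := integral_image_eq_integral_abs_deriv_smul measurableSet_Ioi hd hinj
      (fun v : ℝ => v ^ (a - 1) * Real.exp (-(c * v)))
    rw [phase_image_Ioi, hval] at h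
    rw [h]
    exact (setIntegral_congr_fun measurableSet_Ioi hcongr).symm

/-- The probability density on `(0, ∞)` against which `profile` integrates to `kappa`. -/
noncomputable def density (c t : ℝ) : ℝ :=
  c ^ 2 * (phase t * Real.exp (-(c * phase t)) * (t / (1 + t)))

theorem density_nonneg (c : ℝ) {t : ℝ} (ht : 0 < t) : 0 ≤ density c t := by
  have := phase_pos ht
  rw [density]
  positivity

theorem integrableOn_density {c : ℝ} (hc : 0 < c) : IntegrableOn (density c) (Set.Ioi 0) := by
  have h := (integral_phase_rpow two_pos hc).1.const_mul (c ^ 2)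
  norm_num at h
  exact h

theorem integral_density {c : ℝ} (hc : 0 < c) : ∫ t in Set.Ioi 0, density c t = 1 := by
  have h := (integral_phase_rpow two_pos hc).2
  norm_num [Real.Gamma_two] at h
  simp only [density]
  rw [integral_const_mul, h]
  field_simp

theorem density_mul_phase (c : ℝ) : (fun t => density c t * phase t)
    = fun t => c ^ 2 * (phase t ^ ((3 : ℝ) - 1) * Real.exp (-(c * phase t)) * (t / (1 + t))) := by
  ext t
  rw [density, show (3 : ℝ) - 1 = (2 : ℕ) by norm_num, Real.rpow_natCast]
  ring

theorem integrableOn_density_mul_phase {c : ℝ} (hc : 0 < c) :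
    IntegrableOn (fun t => density c t * phase t) (Set.Ioi 0) := by
  rw [density_mul_phase]
  exact (integral_phase_rpow three_pos hc).1.const_mul (c ^ 2)

theorem integral_density_mul_phase {c : ℝ} (hc : 0 < c) :
    ∫ t in Set.Ioi 0, density c t * phase t = 2 / c := by
  have hG : Real.Gamma 3 = 2 := by
    rw [show (3 : ℝ) = (2 : ℕ) + 1 by norm_num, Real.Gamma_nat_eq_factorial]
    norm_num
  rw [density_mul_phase, integral_const_mul, (integral_phase_rpow three_pos hc).2, hG,
    show (3 : ℝ) = (3 : ℕ) by norm_num, Real.rpow_natCast]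
  field_simp

theorem integral_sqrt_phase {c : ℝ} (hc : 0 < c) :
    IntegrableOn (fun t => √(phase t) * Real.exp (-(c * phase t)) * (t / (1 + t))) (Set.Ioi 0) ∧
    ∫ t in Set.Ioi 0, √(phase t) * Real.exp (-(c * phase t)) * (t / (1 + t))
      = √Real.pi / (2 * c * √c) := by
  have h := integral_phase_rpow (a := 3 / 2) (by norm_num) hc
  have hG : Real.Gamma (3 / 2) = √Real.pi / 2 := by
    have := Real.Gamma_add_one (s := 1 / 2) (by norm_num)
    rw [Real.Gamma_one_half_eq] at this
    rw [show (3 / 2 : ℝ) = 1 / 2 + 1 by norm_num, this]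
    ring
  have hp : (1 / c) ^ (3 / 2 : ℝ) = 1 / (c * √c) := by
    rw [show (3 / 2 : ℝ) = 1 + 1 / 2 by norm_num, Real.rpow_add (by positivity), Real.rpow_one,
      ← Real.sqrt_eq_rpow, Real.sqrt_div zero_le_one, Real.sqrt_one]
    field_simp
  rw [hG, hp, show (3 / 2 : ℝ) - 1 = 1 / 2 by norm_num] at h
  simp only [← Real.sqrt_eq_rpow] at h
  refine ⟨h.1, h.2.trans ?_⟩
  field_simp

theorem exp_neg_mul_phase (n : ℕ) {t : ℝ} (ht : -1 < t) :
    Real.exp (-(n * phase t)) = (1 + t) ^ n * Real.exp (-(n * t)) := by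
  have h : (1 + t) ^ n = Real.exp (n * Real.log (1 + t)) := by
    rw [mul_comm, Real.exp_mul, Real.exp_log (by linarith), Real.rpow_natCast]
  rw [h, ← Real.exp_add, phase]
  congr 1
  ring

theorem tendsto_one_add_pow_mul_exp {n : ℕ} (hn : 1 ≤ n) (j : ℕ) :
    Tendsto (fun t : ℝ => (1 + t) ^ j * Real.exp (-(n * t))) atTop (𝓝 0) := by
  have h1 : Tendsto (fun t : ℝ => 1 + t) atTop atTop :=
    tendsto_atTop_add_const_left _ _ tendsto_id
  have h := ((Real.tendsto_pow_mul_exp_neg_atTop_nhds_zero j).comp h1).mul_const (Real.exp 1)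
  rw [zero_mul] at h
  refine squeeze_zero' ?_ ?_ h
  · filter_upwards [eventually_ge_atTop 0] with t ht
    positivity
  · filter_upwards [eventually_ge_atTop 0] with t ht
    simp only [Function.comp_apply]
    rw [mul_assoc, ← Real.exp_add]
    have : (1 : ℝ) ≤ n := by exact_mod_cast hn
    gcongr
    nlinarith

theorem hasDerivAt_sum_distinctProb {n : ℕ} (hn : 1 ≤ n) (t : ℝ) :
    HasDerivAt (fun t : ℝ => ∑ k ∈ Finset.range (n + 1), distinctProb n k * (1 + t) ^ (n - k))
      (n * (∑ k ∈ Finset.range (n + 1), distinctProb n k * (1 + t) ^ (n - k) - (1 + t) ^ n)) t := by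
  have h := HasDerivAt.fun_sum (u := Finset.range (n + 1)) (x := t)
    (A := fun k (t : ℝ) => distinctProb n k * (1 + t) ^ (n - k))
    (A' := fun k => distinctProb n k * (((n - k : ℕ) : ℝ) * (1 + t) ^ (n - k - 1) * 1))
    fun k _ => (((hasDerivAt_id t).const_add 1).pow (n - k)).const_mul (distinctProb n k)
  refine h.congr_deriv ?_
  rw [Finset.sum_range_succ, Finset.sum_range_succ' (fun k => distinctProb n k * (1 + t) ^ (n - k))]
  simp only [Nat.sub_self, Nat.cast_zero, zero_mul, mul_zero, add_zero, distinctProb_zero,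
    Nat.sub_zero, one_mul, add_sub_cancel_right, Finset.mul_sum]
  refine Finset.sum_congr rfl fun k hk => ?_
  have hk : k ≤ n := (Finset.mem_range.1 hk).le
  rw [← mul_assoc (n : ℝ), distinctProb_succ hn hk, Nat.cast_sub hk, Nat.sub_sub]
  ring

theorem integral_first_moment {n : ℕ} (hn : 1 ≤ n) :
    IntegrableOn (fun t => (n : ℝ) ^ 2 * (t * Real.exp (-(n * phase t)) * (t / (1 + t))))
      (Set.Ioi 0) ∧
    ∫ t in Set.Ioi 0, (n : ℝ) ^ 2 * (t * Real.exp (-(n * phase t)) * (t / (1 + t)))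
      = ∑ k ∈ Finset.range (n + 1), distinctProb n k := by
  -- Since q' = n(q - (1+t)^n), the function G is an antiderivative of the integrand; it vanishes at
  -- infinity and G(0) is minus the sum.
  let q : ℝ → ℝ := fun t => ∑ k ∈ Finset.range (n + 1), distinctProb n k * (1 + t) ^ (n - k)
  let G : ℝ → ℝ := fun t =>
    -((n * ((1 + t) ^ (n + 1) - (1 + t) ^ n) + q t) * Real.exp (-(n * t)))
  have hd : ∀ t ∈ Set.Ici (0 : ℝ), HasDerivAt G
      ((n : ℝ) ^ 2 * (t * Real.exp (-(n * phase t)) * (t / (1 + t)))) t := by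
    intro t ht
    have ht : 0 ≤ t := ht
    have hw := (hasDerivAt_id t).const_add 1
    have h := (((((hw.pow (n + 1)).sub (hw.pow n)).const_mul (n : ℝ)).add
      (hasDerivAt_sum_distinctProb hn t)).mul
      (((hasDerivAt_id t).const_mul (n : ℝ)).neg.exp)).neg
    refine h.congr_deriv ?_
    rw [exp_neg_mul_phase n (by linarith)]
    obtain ⟨m, rfl⟩ := Nat.exists_eq_add_of_le' hn
    simp only [id, Pi.pow_apply, Pi.sub_apply, Pi.add_apply, Pi.neg_apply, Nat.add_sub_cancel]
    have : 1 + t ≠ 0 := by positivity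
    field_simp
    push_cast
    ring
  have hpos : ∀ t ∈ Set.Ioi (0 : ℝ),
      0 ≤ (n : ℝ) ^ 2 * (t * Real.exp (-(n * phase t)) * (t / (1 + t))) := by
    intro t ht
    have ht : 0 < t := ht
    positivity
  have hlim : Tendsto G atTop (𝓝 0) := by
    have h1 := ((tendsto_one_add_pow_mul_exp hn (n + 1)).sub
      (tendsto_one_add_pow_mul_exp hn n)).const_mul (n : ℝ)
    have h2 := tendsto_finsetSum (Finset.range (n + 1)) fun k _ =>
      (tendsto_one_add_pow_mul_exp hn (n - k)).const_mul (distinctProb n k)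
    have h := (h1.add h2).neg
    simp only [sub_self, mul_zero, Finset.sum_const_zero, add_zero, neg_zero] at h
    refine h.congr fun t => ?_
    simp only [G, q, add_mul, Finset.sum_mul]
    congr 2
    · ring
    · exact Finset.sum_congr rfl fun k _ => by ring
  refine ⟨integrableOn_Ioi_deriv_of_nonneg' hd hpos hlim, ?_⟩
  rw [integral_Ioi_of_hasDerivAt_of_nonneg' hd hpos hlim]
  simp [G, q]

theorem integral_density_mul_profile {n : ℕ} (hn : 1 ≤ n) :
    IntegrableOn (fun t => density n t * profile t) (Set.Ioi 0) ∧
    ∫ t in Set.Ioi 0, density n t * profile t = kappa n := by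
  have hn0 : (0 : ℝ) < n := by positivity
  obtain ⟨i1, e1⟩ := integral_first_moment hn
  obtain ⟨i2, e2⟩ := integral_sqrt_phase hn0
  have i2' := i2.const_mul ((n : ℝ) ^ 2 * √2)
  have i3' := (integrableOn_density hn0).const_mul (2 / 3)
  have i12 : IntegrableOn (fun t => (n : ℝ) ^ 2 * (t * Real.exp (-(n * phase t)) * (t / (1 + t)))
      - (n : ℝ) ^ 2 * √2 * (√(phase t) * Real.exp (-(n * phase t)) * (t / (1 + t))))
      (Set.Ioi 0) := i1.sub i2'
  have hcongr : Set.EqOn (fun t => (n : ℝ) ^ 2 * (t * Real.exp (-(n * phase t)) * (t / (1 + t)))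
      - (n : ℝ) ^ 2 * √2 * (√(phase t) * Real.exp (-(n * phase t)) * (t / (1 + t)))
      - 2 / 3 * density n t) (fun t => density n t * profile t) (Set.Ioi 0) := by
    intro t ht
    simp only [density]
    linear_combination (-(n : ℝ) ^ 2 * Real.exp (-(n * phase t)) * (t / (1 + t)))
      * phase_mul_profile ht
  refine ⟨(i12.sub i3').congr_fun hcongr measurableSet_Ioi, ?_⟩
  rw [← setIntegral_congr_fun measurableSet_Ioi hcongr, integral_sub i12 i3',
    integral_sub i1 i2', e1, integral_const_mul, e2, integral_const_mul, integral_density hn0,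
    kappa_eq, R_one_eq hn]
  have hs : √(Real.pi * n / 2) = (n : ℝ) ^ 2 * √2 * (√Real.pi / (2 * n * √n)) := by
    rw [Real.sqrt_div (by positivity), Real.sqrt_mul Real.pi_pos.le]
    have h2 := Real.sq_sqrt (two_pos (α := ℝ)).le
    have hnn := Real.sq_sqrt hn0.le
    have h2p := Real.sqrt_pos.2 (two_pos (α := ℝ))
    have hnp := Real.sqrt_pos.2 hn0
    field_simp
    rw [h2, hnn]
    ring
  rw [hs]
  ring

/-! ### Strict decrease by a single crossing of densities -/

theorem density_lt_density {c d t : ℝ} (hc : 0 < c) (hd : 0 < d) (ht : 0 < t)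
    (h : (d - c) * phase t < 2 * (Real.log d - Real.log c)) : density c t < density d t := by
  have hv := phase_pos ht
  have key : ∀ x : ℝ, 0 < x → density x t
      = phase t * (t / (1 + t)) * Real.exp (2 * Real.log x - x * phase t) := by
    intro x hx
    have hx2 : Real.exp (2 * Real.log x) = x ^ 2 := by
      rw [two_mul, Real.exp_add, Real.exp_log hx]; ring
    rw [density, sub_eq_add_neg, Real.exp_add, hx2]
    ring
  rw [key c hc, key d hd]
  refine mul_lt_mul_of_pos_left (Real.exp_lt_exp.2 ?_) (by positivity)
  linarith

theorem kappa_strictAntiOn : StrictAntiOn kappa (Set.Ici 1) := by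
  intro n hn m hm hnm
  have hn : 1 ≤ n := hn
  have hm : 1 ≤ m := hm
  have hn0 : (0 : ℝ) < n := by positivity
  have hm0 : (0 : ℝ) < m := by positivity
  have hlt : (n : ℝ) < m := by exact_mod_cast hnm
  have hsub : (0 : ℝ) < m - n := by linarith
  have hlog : 0 < Real.log m - Real.log n := sub_pos.2 (Real.log_lt_log hn0 hlt)
  -- t₀ is the point where the two densities cross.
  obtain ⟨t₀, ht₀, hv₀⟩ := exists_phase_eq
    (show 0 < 2 * (Real.log m - Real.log n) / (m - n) by positivity)
  have hv₀ : (m - n) * phase t₀ = 2 * (Real.log m - Real.log n) := by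
    rw [hv₀]; field_simp
  obtain ⟨in1, en⟩ := integral_density_mul_profile hn
  obtain ⟨im1, em⟩ := integral_density_mul_profile hm
  have i1 : IntegrableOn (fun t => density n t * profile t - density m t * profile t)
      (Set.Ioi 0) := in1.sub im1
  have i2 : IntegrableOn (fun t => profile t₀ * (density n t - density m t)) (Set.Ioi 0) :=
    ((integrableOn_density hn0).sub (integrableOn_density hm0)).const_mul (profile t₀)
  have hI : IntegrableOn (fun t => (density n t * profile t - density m t * profile t)
      - profile t₀ * (density n t - density m t)) (Set.Ioi 0) := i1.sub i2
  -- Both densities have mass 1, so subtracting the constant `profile t₀` is free. It turns the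
  -- integrand into a product of two factors that change sign together at t₀.
  have hval : ∫ t in Set.Ioi 0, ((density n t * profile t - density m t * profile t)
      - profile t₀ * (density n t - density m t)) = kappa n - kappa m := by
    rw [integral_sub i1 i2,
      integral_sub in1 im1, en, em, integral_const_mul,
      integral_sub (integrableOn_density hn0) (integrableOn_density hm0), integral_density hn0,
      integral_density hm0]
    ring
  have hpos : ∀ t, 0 < t → t ≠ t₀ → 0 < (density n t * profile t - density m t * profile t)
      - profile t₀ * (density n t - density m t) := by
    intro t ht hne
    have e : (density n t * profile t - density m t * profile t)
      - profile t₀ * (density n t - density m t)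
      = (density n t - density m t) * (profile t - profile t₀) := by ring
    rw [e]
    rcases lt_or_gt_of_ne hne with h | h
    · refine mul_pos_of_neg_of_neg (sub_neg.2 (density_lt_density hn0 hm0 ht ?_))
        (sub_neg.2 (strictMonoOn_profile ht ht₀ h))
      rw [← hv₀]
      exact mul_lt_mul_of_pos_left (strictMonoOn_phase ht.le ht₀.le h) hsub
    · refine mul_pos (sub_pos.2 (density_lt_density hm0 hn0 ht ?_))
        (sub_pos.2 (strictMonoOn_profile ht₀ ht h))
      have := mul_lt_mul_of_pos_left (strictMonoOn_phase ht₀.le ht.le h) hsub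
      linarith
  rw [← sub_pos, ← hval, setIntegral_pos_iff_support_of_nonneg_ae ?_ hI]
  · refine lt_of_lt_of_le ((Measure.measure_Ioo_pos volume).2 ht₀) (measure_mono fun t ht => ?_)
    exact ⟨(hpos t ht.1 ht.2.ne).ne', ht.1⟩
  · refine (ae_restrict_iff' measurableSet_Ioi).2 (Eventually.of_forall fun t ht => ?_)
    rcases eq_or_ne t t₀ with rfl | h
    · simp only [Pi.zero_apply]
      exact le_of_eq (by ring)
    · exact (hpos t ht h).le

/-! ### Limit of kappa -/

theorem le_two_mul_phase_add_one {t : ℝ} (ht : 0 < t) : t ≤ 2 * phase t + 1 := by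
  have h2 := Real.log_le_sub_one_of_pos (show (0 : ℝ) < (1 + t) / 2 by positivity)
  rw [Real.log_div (by positivity) two_ne_zero] at h2
  have := Real.log_two_lt_d9
  rw [phase]
  linarith

theorem exists_profile_bound {ε : ℝ} (hε : 0 < ε) :
    ∃ C, ∀ t, 0 < t → -ε ≤ profile t ∧ profile t ≤ ε + C * phase t := by
  have h := tendsto_profile.eventually (Icc_mem_nhds (neg_lt_zero.2 hε) hε)
  obtain ⟨δ, hδ, hsub⟩ := mem_nhdsGT_iff_exists_Ioc_subset.1 h
  have hδ : 0 < δ := hδ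
  have hp := phase_pos hδ
  -- Chosen so that for t > δ, where r = `phase t / phase δ` is at least 1, v(Cv) = 2vr + r²
  -- dominates 2v + 1.
  refine ⟨2 / phase δ + 1 / phase δ ^ 2, fun t ht => ?_⟩
  have hv := phase_pos ht
  rcases le_or_gt t δ with htδ | htδ
  · have := hsub ⟨ht, htδ⟩
    refine ⟨this.1, this.2.trans (le_add_of_nonneg_right (by positivity))⟩
  · refine ⟨(hsub ⟨hδ, le_rfl⟩).1.trans (strictMonoOn_profile hδ ht htδ).le, ?_⟩
    have hr : 1 ≤ phase t / phase δ := (one_le_div hp).2 (strictMonoOn_phase hδ.le ht.le htδ).le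
    have h1 := phase_mul_profile ht
    have h2 := le_two_mul_phase_add_one ht
    have h3 : phase t * profile t ≤ 2 * phase t + 1 := by
      have : 0 ≤ √2 * √(phase t) := by positivity
      linarith
    have h4 : 2 * phase t + 1 ≤ phase t * ((2 / phase δ + 1 / phase δ ^ 2) * phase t) := by
      have e : phase t * ((2 / phase δ + 1 / phase δ ^ 2) * phase t)
          = 2 * phase t * (phase t / phase δ) + (phase t / phase δ) ^ 2 := by
        field_simp
      rw [e]
      nlinarith
    have := le_of_mul_le_mul_left (h3.trans h4) hv
    linarith

theorem tendsto_kappa : Tendsto kappa atTop (𝓝 0) := by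
  rw [Metric.tendsto_atTop']
  intro ε hε
  obtain ⟨C, hC⟩ := exists_profile_bound (half_pos hε)
  have hlim : Tendsto (fun n : ℕ => ε / 2 + C * (2 / (n : ℝ))) atTop (𝓝 (ε / 2)) := by
    simpa using ((tendsto_const_div_atTop_nhds_zero_nat 2).const_mul C).const_add (ε / 2)
  obtain ⟨N, hN⟩ := eventually_atTop.1 (hlim.eventually_lt_const (half_lt_self hε))
  refine ⟨N, fun n hn => ?_⟩
  have hn1 : 1 ≤ n := by omega
  have hn0 : (0 : ℝ) < n := by positivity
  obtain ⟨hi, he⟩ := integral_density_mul_profile hn1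
  have i1 := integrableOn_density hn0
  have i2 := integrableOn_density_mul_phase hn0
  have hup : kappa n ≤ ε / 2 + C * (2 / n) := by
    rw [← he, ← integral_density_mul_phase hn0, ← mul_one (ε / 2), ← integral_density hn0,
      ← integral_const_mul, ← integral_const_mul, ← integral_add (i1.const_mul _) (i2.const_mul _)]
    refine setIntegral_mono_on hi ((i1.const_mul _).add (i2.const_mul _)) measurableSet_Ioi
      fun t ht => ?_
    refine (mul_le_mul_of_nonneg_left (hC t ht).2 (density_nonneg n ht)).trans_eq ?_
    ring
  have hlow : -(ε / 2) ≤ kappa n := by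
    rw [← he, ← mul_one (-(ε / 2)), ← integral_density hn0, ← integral_const_mul]
    refine setIntegral_mono_on (i1.const_mul _) hi measurableSet_Ioi fun t ht => ?_
    rw [mul_comm]
    exact mul_le_mul_of_nonneg_left (hC t ht).1 (density_nonneg n ht)
  rw [Real.dist_0_eq_abs, abs_lt]
  exact ⟨by linarith, hup.trans_lt (hN n hn.le)⟩

end Linear

theorem theorem9 :
    (∀ (n : ℕ), 1 ≤ n →
      ∀ (Ω : Type*) [MeasurableSpace Ω] (P : Measure Ω) [IsProbabilityMeasure P]
        (x : Fin n → Ω → Fin n), (∀ i, Measurable (x i)) → iIndepFun x P →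
        (∀ i k, P.real {ω | x i ω = k} = 1 / (n : ℝ)) →
        (∫ ω, (Linear.comparisons (fun i => x i ω) : ℝ) ∂P)
            = 1 - (n ! : ℝ) / (n : ℝ) ^ n + Linear.R 1 n ∧
        (∫ ω, (Linear.comparisons (fun i => x i ω) : ℝ) ∂P)
            = √(Real.pi * n / 2) + 2 / 3 + Linear.kappa n - (n ! : ℝ) / (n : ℝ) ^ n) ∧
    StrictAntiOn Linear.kappa (Set.Ici 1) ∧
    Tendsto Linear.kappa atTop (𝓝 0) := by
  refine ⟨fun n hn Ω _ P _ x hx hind hunif => ?_, Linear.kappa_strictAntiOn, Linear.tendsto_kappa⟩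
  have h := Linear.integral_comparisons hn P x hx hind hunif
  refine ⟨h, h.trans ?_⟩
  rw [Linear.kappa_eq]
  ring
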